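/- Let $p\in[1,\infty)$, let $\mathcal P_p(\mathbb R^d)$ be the set of Borel probability measures on $\mathbb R^d$ with finite moment of order $p$, and for $P,Q\in\mathcal P_p(\mathbb R^d)$ let $W_p(P,Q)=\bigl(\inf_\gamma\int\|x-y\|^p\,d\gamma(x,y)\bigr)^{1/p}$, the infimum being over all couplings $\gamma$ of $P$ and $Q$ and $\|\cdot\|$ the Euclidean norm. Let $Q_0\in\mathcal P_p(\mathbb R^d)$ and let $G$ be a group (under composition) of measurable bijections of $\mathbb R^d$, parametrized one-to-one as $G=\{g_\theta:\theta\in\Theta\}$ with $\Theta\subseteq\mathbb R^k$. Put $P_\theta=(g_\theta)_\#Q_0$ and $\mathcal M=\{P_\theta:\theta\in\Theta\}$. Assume: (a) (identifiability) the map $g\mapsto g_\#Q_0$ is one-to-one on $G$; (b) for every $g\in G$ there is $c_g>0$ with $\|g(x)\|\le c_g(1+\|x\|)$ for all $x\in\mathbb R^d$; (c) for every $\theta\in\Theta$ there is $m_\theta>0$ such that, for all $\theta'\in\Theta$ in some neighbourhood of $\theta$, $$\sup_{x\in\mathbb R^d}\frac{\|g_{\theta'}^{-1}(g_\theta(x))-x\|}{1+\|x\|}\le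 m_\theta\|\theta'-\theta\|.$$ Let $\hat\theta_n=\theta_n(X_1,\dots,X_n)$ be a sequence of estimators, where $\theta_n:(\mathbb R^d)^n\to\Theta$ is measurable, such that (d) (equivariance) for all sufficiently large $n$ and every $g\in G$, one has $\theta_n(g(x_1),\dots,g(x_n))=\bar g(\theta_n(x_1,\dots,x_n))$ for $P_\theta^n$-almost every $(x_1,\dots,x_n)$, for every $\theta\in\Theta$ (in particular, it suffices that this holds for every sample), where $\bar g:\Theta\to\Theta$ is defined by $g\circ g_\theta=g_{\bar g(\theta)}$; (e) (weak consistency) for every $\theta\in\Theta$, $\hat\theta_n\to\theta$ in $P_\theta^n$-probability. Here $P^n$ is the law of an i.i.d. sample $X_1,\dots,X_n$ from $P$. Let $$T_{\mathcal M,n}=W_p^p\Bigl(\tfrac1n\sum_{i=1}^n\delta_{g_{\hat\theta_n}^{-1}(X_i)},\,Q_0\Bigr),\qquad F_{\mathcal M,n}(t)=Q_0^n[T_{\mathcal M,n}\le t],$$ and, for $\alpha\in(0,1)$, let $\phi^n_{\mathcal M}=1$ if $1-F_{\mathcal M,n}(T_{\mathcal M,n})\le\alpha$ and $\phi^n_{\mathcal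 M}=0$ otherwise. Then: (i) for every $\theta\in\Theta$, $T_{\mathcal M,n}\to0$ in $P_\theta^n$-probability as $n\to\infty$; (ii) for every $P\in\mathcal P_p(\mathbb R^d)\setminus\mathcal M$ such that $\hat\theta_n$ converges in $P^n$-probability to some $\theta\in\Theta$, and for every $\alpha\in(0,1)$, $P^n[\phi^n_{\mathcal M}=1]\to1$ as $n\to\infty$. -/

import Mathlib

open MeasureTheory Filter Topology
open scoped ENNReal

namespace GroupGoF

/-- Euclidean space `ℝ^d` with the Euclidean norm. -/
abbrev E (d : ℕ) : Type := EuclideanSpace ℝ (Fin d)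

/-- The Borel probability measures on `ℝ^d` with a finite moment of order `p`. -/
def probP (d : ℕ) (p : ℝ) : Set (Measure (E d)) :=
  {P | IsProbabilityMeasure P ∧ ∫⁻ x, ENNReal.ofReal (‖x‖ ^ p) ∂P < ∞}

/-- The couplings of `P` and `Q`: measures on the product space with marginals `P` and `Q`. -/
def couplings {d : ℕ} (P Q : Measure (E d)) : Set (Measure (E d × E d)) :=
  {γ | γ.map Prod.fst = P ∧ γ.map Prod.snd = Q}

/-- The `p`-Wasserstein distance. The infimum is computed in `[0, ∞]`; it is finite whenever
`P` and `Q` are probability measures with finite moments of order `p`. -/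
noncomputable def wasserstein {d : ℕ} (p : ℝ) (P Q : Measure (E d)) : ℝ :=
  ((⨅ γ ∈ couplings P Q, ∫⁻ z, ENNReal.ofReal (‖z.1 - z.2‖ ^ p) ∂γ) ^ (1 / p)).toReal

/-- The empirical distribution `n⁻¹ ∑ δ_{z i}` of a sample of size `n`. -/
noncomputable def empirical {d n : ℕ} (z : Fin n → E d) : Measure (E d) :=
  (n : ℝ≥0∞)⁻¹ • ∑ i, Measure.dirac (z i)

/-- The law `P^n` of an i.i.d. sample of size `n` from `P`. -/
noncomputable def sampleLaw {d : ℕ} (P : Measure (E d)) (n : ℕ) : Measure (Fin n → E d) :=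
  Measure.pi fun _ => P

/-- Convergence in `P^n`-probability of the statistics `Y n (X_1, …, X_n)` to the constant `y`. -/
def TendstoInProb {d : ℕ} {S : Type*} [PseudoMetricSpace S] (P : Measure (E d))
    (Y : (n : ℕ) → (Fin n → E d) → S) (y : S) : Prop :=
  ∀ ε : ℝ, 0 < ε →
    Tendsto (fun n => sampleLaw P n {x | ε ≤ dist (Y n x) y}) atTop (𝓝 0)

section Family

variable {d k : ℕ} {G : Subgroup (Equiv.Perm (E d))} {Θ : Set (E k)}

/-- `P_θ = (g_θ)_# Q₀`. -/
noncomputable def law (Q₀ : Measure (E d)) (g : Θ ≃ G) (θ : Θ) : Measure (E d) :=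
  Q₀.map (g θ : Equiv.Perm (E d))

/-- The group family `{P_θ : θ ∈ Θ}`. -/
def model (Q₀ : Measure (E d)) (g : Θ ≃ G) : Set (Measure (E d)) :=
  Set.range (law Q₀ g)

/-- The action of `h ∈ G` on the parameter space, characterized by `h ∘ g_θ = g_{bar h θ}`. -/
def bar (g : Θ ≃ G) (h : G) (θ : Θ) : Θ := g.symm (h * g θ)

theorem bar_spec (g : Θ ≃ G) (h : G) (θ : Θ) (x : E d) :
    (g (bar g h θ) : Equiv.Perm (E d)) x = (h : Equiv.Perm (E d)) ((g θ : Equiv.Perm (E d)) x) := by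
  simp [bar]

/-- Equivariance of an estimator sequence: for all large `n` and all `h ∈ G`,
`θ_n(h(x_1), …, h(x_n)) = bar h (θ_n(x_1, …, x_n))` for almost every sample under the model. -/
def IsEquivariant (Q₀ : Measure (E d)) (g : Θ ≃ G) (est : (n : ℕ) → (Fin n → E d) → Θ) : Prop :=
  ∀ᶠ n in atTop, ∀ h : G, ∀ θ : Θ, ∀ᵐ x ∂(sampleLaw (law Q₀ g θ) n),
    est n (fun i => (h : Equiv.Perm (E d)) (x i)) = bar g h (est n x)

/-- Weak consistency: under every `P_θ`, the estimator converges in probability to `θ`. -/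
def IsWeaklyConsistent (Q₀ : Measure (E d)) (g : Θ ≃ G)
    (est : (n : ℕ) → (Fin n → E d) → Θ) : Prop :=
  ∀ θ : Θ, TendstoInProb (law Q₀ g θ) est θ

/-- The residuals `g_{θ̂_n}⁻¹(x_i)`. -/
def residuals (g : Θ ≃ G) (est : (n : ℕ) → (Fin n → E d) → Θ) (n : ℕ) (x : Fin n → E d) :
    Fin n → E d :=
  fun i => (g (est n x) : Equiv.Perm (E d)).symm (x i)

/-- The test statistic: `W_p^p` between the empirical law of the residuals and `Q₀`. -/
noncomputable def testStat (p : ℝ) (Q₀ : Measure (E d)) (g : Θ ≃ G)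
    (est : (n : ℕ) → (Fin n → E d) → Θ) (n : ℕ) (x : Fin n → E d) : ℝ :=
  wasserstein p (empirical (residuals g est n x)) Q₀ ^ p

/-- The distribution function of the test statistic for samples from `Q₀`. -/
noncomputable def nullCdf (p : ℝ) (Q₀ : Measure (E d)) (g : Θ ≃ G)
    (est : (n : ℕ) → (Fin n → E d) → Θ) (n : ℕ) (t : ℝ) : ℝ :=
  (sampleLaw Q₀ n).real {x | testStat p Q₀ g est n x ≤ t}

open Classical in
/-- The test of level `α`: reject when the `p`-value is at most `α`. -/
noncomputable def test (p α : ℝ) (Q₀ : Measure (E d)) (g : Θ ≃ G)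
    (est : (n : ℕ) → (Fin n → E d) → Θ) (n : ℕ) (x : Fin n → E d) : ℕ :=
  if 1 - nullCdf p Q₀ g est n (testStat p Q₀ g est n x) ≤ α then 1 else 0

end Family

end GroupGoF

/-! Suppose `est n` tends to `θ` in `P^n`-probability and put `Q = (g_θ⁻¹)_# P`. The whole proof
rests on one limit: the empirical law of the residuals tends to `Q` in transport cost
(`vanishInProb_transportCost_residuals`). Pairing residuals with the points `g_θ⁻¹(X_i)` index by
index, the Lipschitz condition bounds the cost by `(m * dist (est n x) θ) ^ p` times an average of
bounded expectation (`VanishInProb.of_mul`). The empirical law of the `g_θ⁻¹(X_i)` then tends to `Q`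
by a law of large numbers for the transport cost (`vanishInProb_transportCost_empirical`):
approximate the map in `L^p` by a simple function, for which a total variation bound leaves finitely
many frequencies to control.

For `P = P_θ` one has `Q = Q₀`, which is (i). For `P` outside the model `Q ≠ Q₀`, so their cost is
positive (`eq_of_transportCost_eq_zero`). By the triangle inequality the statistic then exceeds some
fixed `a > 0` with probability tending to one, while (i) at the identity of `G` says that under `Q₀`
it falls below `a` with probability tending to one. Hence the p-value drops below `α`, which is
(ii). -/

open scoped ProbabilityTheory

/-! ### Transport cost: triangle inequality, definiteness, total variation bound. -/

namespace GroupGoF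

/-- The optimal transport cost for `‖x - y‖ ^ p`, with values in `[0, ∞]`. -/
noncomputable def transportCost {d : ℕ} (p : ℝ) (P Q : Measure (E d)) : ℝ≥0∞ :=
  ⨅ γ ∈ couplings P Q, ∫⁻ z, ‖z.1 - z.2‖ₑ ^ p ∂γ

section TransportCost

variable {d : ℕ} {p : ℝ}

theorem ofReal_norm_rpow (hp : 0 ≤ p) (x : E d) : ENNReal.ofReal (‖x‖ ^ p) = ‖x‖ₑ ^ p := by
  rw [← ENNReal.ofReal_rpow_of_nonneg (norm_nonneg x) hp, ofReal_norm]

theorem wasserstein_rpow (hp : 0 < p) (P Q : Measure (E d)) :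
    wasserstein p P Q ^ p = (transportCost p P Q).toReal := by
  simp only [wasserstein, transportCost, ofReal_norm_rpow hp.le]
  rw [ENNReal.toReal_rpow, ← ENNReal.rpow_mul, one_div, inv_mul_cancel₀ hp.ne', ENNReal.rpow_one]

theorem transportCost_le {P Q : Measure (E d)} {γ : Measure (E d × E d)} (h : γ ∈ couplings P Q) :
    transportCost p P Q ≤ ∫⁻ z, ‖z.1 - z.2‖ₑ ^ p ∂γ :=
  iInf₂_le γ h

theorem measurable_enorm_sub_rpow :
    Measurable (fun z : E d × E d => ‖z.1 - z.2‖ₑ ^ p) := by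
  fun_prop

theorem transportCost_map_map_le {Ω : Type*} [MeasurableSpace Ω] {μ : Measure Ω} {f h : Ω → E d}
    (hf : Measurable f) (hh : Measurable h) :
    transportCost p (μ.map f) (μ.map h) ≤ ∫⁻ ω, ‖f ω - h ω‖ₑ ^ p ∂μ := by
  have hc : μ.map (fun ω => (f ω, h ω)) ∈ couplings (μ.map f) (μ.map h) := by
    constructor
    · rw [Measure.map_map measurable_fst (hf.prodMk hh)]; rfl
    · rw [Measure.map_map measurable_snd (hf.prodMk hh)]; rfl
  refine (transportCost_le hc).trans_eq ?_
  rw [lintegral_map measurable_enorm_sub_rpow (hf.prodMk hh)]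

theorem swap_mem_couplings {P Q : Measure (E d)} {γ : Measure (E d × E d)}
    (h : γ ∈ couplings P Q) : γ.map Prod.swap ∈ couplings Q P := by
  constructor
  · rw [Measure.map_map measurable_fst measurable_swap]; exact h.2
  · rw [Measure.map_map measurable_snd measurable_swap]; exact h.1

theorem transportCost_comm_le (P Q : Measure (E d)) :
    transportCost p P Q ≤ transportCost p Q P := by
  refine le_iInf₂ fun γ hγ => (transportCost_le (swap_mem_couplings hγ)).trans_eq ?_
  rw [lintegral_map measurable_enorm_sub_rpow measurable_swap]
  simp_rw [Prod.fst_swap, Prod.snd_swap, ← edist_eq_enorm_sub, edist_comm]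

theorem transportCost_comm (P Q : Measure (E d)) :
    transportCost p P Q = transportCost p Q P :=
  (transportCost_comm_le P Q).antisymm (transportCost_comm_le Q P)

theorem isFiniteMeasure_of_mem_couplings {P Q : Measure (E d)} [IsFiniteMeasure P]
    {γ : Measure (E d × E d)} (h : γ ∈ couplings P Q) : IsFiniteMeasure γ := by
  have : γ Set.univ = P Set.univ := by
    rw [← h.1, Measure.map_apply measurable_fst MeasurableSet.univ, Set.preimage_univ]
  exact ⟨this ▸ measure_lt_top P _⟩

/-- Gluing of two couplings along their common marginal. -/
theorem exists_gluing {P Q R : Measure (E d)} [IsFiniteMeasure P] [IsFiniteMeasure Q]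
    {γ₁ γ₂ : Measure (E d × E d)} (h₁ : γ₁ ∈ couplings P Q) (h₂ : γ₂ ∈ couplings Q R) :
    ∃ τ : Measure (E d × (E d × E d)),
      τ.map (fun w => (w.2.1, w.1)) = γ₁ ∧ τ.map (fun w => (w.1, w.2.2)) = γ₂ := by
  have h₁' := swap_mem_couplings h₁
  have := isFiniteMeasure_of_mem_couplings h₁'
  have := isFiniteMeasure_of_mem_couplings h₂
  have disint : ∀ ρ : Measure (E d × E d), IsFiniteMeasure ρ → ρ.fst = Q →
      ∃ κ : ProbabilityTheory.Kernel (E d) (E d), ProbabilityTheory.IsMarkovKernel κ ∧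
        Q ⊗ₘ κ = ρ := fun ρ _ hρ =>
    ⟨ρ.condKernel, inferInstance, by rw [← hρ, ρ.disintegrate ρ.condKernel]⟩
  obtain ⟨κ₁, _, d₁⟩ := disint (γ₁.map Prod.swap) inferInstance h₁'.1
  obtain ⟨κ₂, _, d₂⟩ := disint γ₂ inferInstance h₂.1
  -- The outer coordinates are drawn conditionally independently given the shared coordinate.
  refine ⟨Q ⊗ₘ (κ₁ ×ₖ κ₂), ?_, ?_⟩
  · have e : (Q ⊗ₘ (κ₁ ×ₖ κ₂)).map (Prod.map id Prod.fst) = γ₁.map Prod.swap := by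
      rw [← Measure.compProd_map measurable_fst, ← d₁, ← ProbabilityTheory.Kernel.fst_eq,
        ProbabilityTheory.Kernel.fst_prod]
    have h := congrArg (Measure.map Prod.swap) e
    rw [Measure.map_map measurable_swap (by fun_prop), Measure.map_map measurable_swap
      measurable_swap, Prod.swap_swap_eq, Measure.map_id] at h
    exact h
  · have e : (Q ⊗ₘ (κ₁ ×ₖ κ₂)).map (Prod.map id Prod.snd) = γ₂ := by
      rw [← Measure.compProd_map measurable_snd, ← d₂, ← ProbabilityTheory.Kernel.snd_eq,
        ProbabilityTheory.Kernel.snd_prod]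
    exact e

theorem enorm_sub_rpow_le (hp : 1 ≤ p) (x y z : E d) :
    ‖x - z‖ₑ ^ p ≤ 2 ^ (p - 1) * (‖x - y‖ₑ ^ p + ‖y - z‖ₑ ^ p) := by
  refine le_trans ?_ (ENNReal.rpow_add_le_mul_rpow_add_rpow _ _ hp)
  refine ENNReal.rpow_le_rpow ?_ (by linarith)
  simpa [edist_eq_enorm_sub] using edist_triangle x y z

/-- Convexity of `t ↦ t ^ p` costs a factor `2 ^ (p - 1)` but avoids Minkowski and `p`-th roots. The
factor is harmless, since only vanishing and positivity of costs matter. -/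
theorem transportCost_triangle (hp : 1 ≤ p) (P Q R : Measure (E d)) [IsFiniteMeasure P]
    [IsFiniteMeasure Q] :
    transportCost p P R ≤ 2 ^ (p - 1) * (transportCost p P Q + transportCost p Q R) := by
  have key : ∀ γ₁ ∈ couplings P Q, ∀ γ₂ ∈ couplings Q R, transportCost p P R ≤
      2 ^ (p - 1) * (∫⁻ z, ‖z.1 - z.2‖ₑ ^ p ∂γ₁ + ∫⁻ z, ‖z.1 - z.2‖ₑ ^ p ∂γ₂) := by
    intro γ₁ h₁ γ₂ h₂
    obtain ⟨τ, t₁, t₂⟩ := exists_gluing h₁ h₂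
    have m₁ : Measurable (fun w : E d × (E d × E d) => (w.2.1, w.1)) := by fun_prop
    have m₂ : Measurable (fun w : E d × (E d × E d) => (w.1, w.2.2)) := by fun_prop
    have e₁ : P = τ.map (fun w => w.2.1) := by
      rw [← h₁.1, ← t₁, Measure.map_map measurable_fst m₁]; rfl
    have e₂ : R = τ.map (fun w => w.2.2) := by
      rw [← h₂.2, ← t₂, Measure.map_map measurable_snd m₂]; rfl
    calc transportCost p P R ≤ ∫⁻ w, ‖w.2.1 - w.2.2‖ₑ ^ p ∂τ := by
          rw [e₁, e₂]; exact transportCost_map_map_le (by fun_prop) (by fun_prop)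
      _ ≤ ∫⁻ w, 2 ^ (p - 1) * (‖w.2.1 - w.1‖ₑ ^ p + ‖w.1 - w.2.2‖ₑ ^ p) ∂τ :=
          lintegral_mono fun w => enorm_sub_rpow_le hp _ _ _
      _ = _ := by
          rw [lintegral_const_mul _ (by fun_prop), lintegral_add_left (by fun_prop), ← t₁, ← t₂,
            lintegral_map measurable_enorm_sub_rpow m₁, lintegral_map measurable_enorm_sub_rpow m₂]
  have hC : (2 : ℝ≥0∞) ^ (p - 1) ≠ ∞ := by finiteness
  have hC0 : (2 : ℝ≥0∞) ^ (p - 1) ≠ 0 := by simp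
  rw [← ENNReal.div_le_iff' hC0 hC]
  have e : ∀ μ ν : Measure (E d), transportCost p μ ν =
      ⨅ γ : couplings μ ν, ∫⁻ z, ‖z.1 - z.2‖ₑ ^ p ∂(γ : Measure (E d × E d)) := fun μ ν => by
    rw [transportCost, iInf_subtype']
  rw [e P Q, e Q R]
  simp only [ENNReal.iInf_add, ENNReal.add_iInf]
  refine le_iInf fun b => le_iInf fun a => ?_
  rw [ENNReal.div_le_iff' hC0 hC]
  exact key a.1 a.2 b.1 b.2

/-- The cost to the Dirac mass at `0` is at most the `p`-th moment, so one passes through that mass.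
-/
theorem transportCost_lt_top (hp : 1 ≤ p) {P Q : Measure (E d)} [IsProbabilityMeasure P]
    [IsProbabilityMeasure Q] (hP : ∫⁻ x, ‖x‖ₑ ^ p ∂P < ∞) (hQ : ∫⁻ x, ‖x‖ₑ ^ p ∂Q < ∞) :
    transportCost p P Q < ∞ := by
  have key : ∀ μ : Measure (E d), IsProbabilityMeasure μ → ∫⁻ x, ‖x‖ₑ ^ p ∂μ < ∞ →
      transportCost p μ (Measure.dirac 0) < ∞ := by
    intro μ _ hμ
    have := transportCost_map_map_le (p := p) (μ := μ) measurable_id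
      (measurable_const (a := (0 : E d)))
    simp only [Measure.map_id, Measure.map_const, measure_univ, one_smul, id, sub_zero] at this
    exact this.trans_lt hμ
  refine (transportCost_triangle hp P (Measure.dirac 0) Q).trans_lt ?_
  rw [transportCost_comm (Measure.dirac 0) Q]
  have := key P inferInstance hP
  have := key Q inferInstance hQ
  finiteness

/-- Mass starting in `F` ends within `δ` of `F` unless it travels at least `δ`; Markov's inequality
bounds the latter. -/
theorem measure_le_cthickening_add {P Q : Measure (E d)} {γ : Measure (E d × E d)}
    (h : γ ∈ couplings P Q) (hp : 0 < p) {F : Set (E d)} (hF : IsClosed F) {δ : ℝ} (hδ : 0 < δ) :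
    P F ≤ Q (Metric.cthickening δ F) +
      (∫⁻ z, ‖z.1 - z.2‖ₑ ^ p ∂γ) / ENNReal.ofReal δ ^ p := by
  calc P F = γ (Prod.fst ⁻¹' F) := by
        rw [← h.1, Measure.map_apply measurable_fst hF.measurableSet]
    _ ≤ γ (Prod.snd ⁻¹' Metric.cthickening δ F ∪
          {z | ENNReal.ofReal δ ^ p ≤ ‖z.1 - z.2‖ₑ ^ p}) := by
        refine measure_mono fun z hz => ?_
        by_cases hc : ENNReal.ofReal δ ^ p ≤ ‖z.1 - z.2‖ₑ ^ p
        · exact Or.inr hc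
        · left
          rw [ENNReal.rpow_le_rpow_iff hp, not_le, ← edist_eq_enorm_sub, edist_comm] at hc
          rw [Set.mem_preimage, Metric.mem_cthickening_iff]
          exact (Metric.infEDist_le_edist_of_mem (show z.1 ∈ F from hz)).trans hc.le
    _ ≤ _ := by
        refine (measure_union_le _ _).trans (add_le_add ?_ ?_)
        · rw [← h.2, Measure.map_apply measurable_snd Metric.isClosed_cthickening.measurableSet]
        · exact meas_ge_le_lintegral_div (by fun_prop) (by simp [hδ]) (by finiteness)

/-- Near-optimal couplings suffice: the cost goes to zero at fixed `δ`, then the thickenings shrink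
to the closed set. No optimal coupling is needed. -/
theorem measure_closed_le_of_transportCost_eq_zero (hp : 0 < p) {P Q : Measure (E d)}
    [IsFiniteMeasure Q] (h : transportCost p P Q = 0) {F : Set (E d)} (hF : IsClosed F) :
    P F ≤ Q F := by
  have key : ∀ δ : ℝ, 0 < δ → P F ≤ Q (Metric.cthickening δ F) := by
    intro δ hδ
    have hD : ENNReal.ofReal δ ^ p ≠ 0 := by simp [hδ]
    have hD' : ENNReal.ofReal δ ^ p ≠ ∞ := by finiteness
    refine ENNReal.le_of_forall_pos_le_add fun ε hε _ => ?_
    have hpos : transportCost p P Q < ε * ENNReal.ofReal δ ^ p := by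
      rw [h]; exact ENNReal.mul_pos (by simpa using hε.ne') hD
    simp only [transportCost, iInf_lt_iff] at hpos
    obtain ⟨γ, hγ, hlt⟩ := hpos
    refine (measure_le_cthickening_add hγ hp hF hδ).trans ?_
    gcongr
    exact ENNReal.div_le_of_le_mul hlt.le
  have ht := tendsto_measure_cthickening_of_isClosed (μ := Q) ⟨1, one_pos, measure_ne_top _ _⟩ hF
  refine ge_of_tendsto (ht.mono_left (nhdsWithin_le_nhds (s := Set.Ioi 0))) ?_
  filter_upwards [self_mem_nhdsWithin] with δ hδ using key δ hδ

theorem eq_of_transportCost_eq_zero (hp : 0 < p) {P Q : Measure (E d)}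
    [IsProbabilityMeasure P] [IsProbabilityMeasure Q] (h : transportCost p P Q = 0) : P = Q := by
  refine ext_of_generate_finite _ (borel_eq_generateFrom_isClosed (α := E d) ▸
    BorelSpace.measurable_eq) isPiSystem_isClosed (fun F hF => ?_) (by simp)
  exact (measure_closed_le_of_transportCost_eq_zero hp h hF).antisymm
    (measure_closed_le_of_transportCost_eq_zero hp (transportCost_comm P Q ▸ h) hF)

/-- Two measures with the common part `κ` are coupled by leaving `κ` where it is. -/
theorem transportCost_add_le (hp : 0 < p) {κ μ ν : Measure (E d)} [IsFiniteMeasure κ]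
    [IsFiniteMeasure μ] [IsFiniteMeasure ν] (huniv : μ Set.univ = ν Set.univ) {D : ℝ≥0∞}
    (hD : ∀ᵐ x ∂μ, ∀ᵐ y ∂ν, ‖x - y‖ₑ ^ p ≤ D) :
    transportCost p (κ + μ) (κ + ν) ≤ D * μ Set.univ := by
  by_cases h0 : μ Set.univ = 0
  · have hν : ν = 0 := Measure.measure_univ_eq_zero.1 (huniv ▸ h0)
    have hμ : μ = 0 := Measure.measure_univ_eq_zero.1 h0
    subst hν hμ
    have := transportCost_map_map_le (p := p) (μ := κ) measurable_id measurable_id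
    simpa [hp] using this
  have ht : μ Set.univ ≠ ∞ := measure_ne_top _ _
  set t := μ Set.univ
  -- The common part sits on the diagonal at no cost; the rest is moved independently, with `t⁻¹`
  -- restoring the marginals.
  have hc : κ.map (fun x => (x, x)) + t⁻¹ • μ.prod ν ∈ couplings (κ + μ) (κ + ν) := by
    have hd : Measurable (fun x : E d => (x, x)) := by fun_prop
    constructor
    · rw [Measure.map_add _ _ measurable_fst, Measure.map_map measurable_fst hd, Measure.map_smul,
        Measure.map_fst_prod, ← huniv, smul_smul, ENNReal.inv_mul_cancel h0 ht, one_smul]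
      congr 1
      exact Measure.map_id
    · rw [Measure.map_add _ _ measurable_snd, Measure.map_map measurable_snd hd, Measure.map_smul,
        Measure.map_snd_prod, smul_smul, ENNReal.inv_mul_cancel h0 ht, one_smul]
      congr 1
      exact Measure.map_id
  refine (transportCost_le hc).trans ?_
  rw [lintegral_add_measure, lintegral_map measurable_enorm_sub_rpow (by fun_prop),
    lintegral_smul_measure, lintegral_prod _ (by fun_prop)]
  simp only [sub_self, enorm_zero, ENNReal.zero_rpow_of_pos hp, lintegral_zero, zero_add,
    smul_eq_mul]
  calc t⁻¹ * ∫⁻ x, ∫⁻ y, ‖x - y‖ₑ ^ p ∂ν ∂μ ≤ t⁻¹ * ∫⁻ _, D * t ∂μ := by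
        gcongr 1
        refine lintegral_mono_ae ?_
        filter_upwards [hD] with x hx
        refine (lintegral_mono_ae hx).trans ?_
        rw [lintegral_const, ← huniv]
    _ = D * t := by
        rw [lintegral_const, mul_comm (D * t), ← mul_assoc, ENNReal.inv_mul_cancel h0 ht, one_mul]

/-- Total variation bound for the transport cost between finitely supported measures. -/
theorem transportCost_le_sum (hp : 0 < p) {P Q : Measure (E d)} [IsProbabilityMeasure P]
    [IsProbabilityMeasure Q] (A : Finset (E d)) (hP : P (A : Set (E d))ᶜ = 0)
    (hQ : Q (A : Set (E d))ᶜ = 0) :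
    transportCost p P Q ≤ (∑ a ∈ A, ∑ b ∈ A, ‖a - b‖ₑ ^ p) * ∑ a ∈ A, (P {a} - Q {a}) := by
  classical
  have repr : ∀ R : Measure (E d), R (A : Set (E d))ᶜ = 0 →
      R = ∑ a ∈ A, R {a} • Measure.dirac a := by
    intro R hR
    ext s hs
    rw [← measure_inter_add_sdiff s A.measurableSet,
      measure_mono_null (s := s \ A) (fun x hx => hx.2) hR, add_zero, Measure.finsetSum_apply]
    have : s ∩ A = ((A.filter (· ∈ s) : Finset (E d)) : Set (E d)) := by ext; simp [and_comm]
    rw [this, ← sum_measure_singleton, Finset.sum_filter]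
    refine Finset.sum_congr rfl fun a _ => ?_
    by_cases ha : a ∈ s <;> simp [ha, Measure.dirac_apply' a hs]
  -- Atomwise minimum and the two excesses; truncated subtraction makes each excess a positive part.
  set κ : Measure (E d) := ∑ a ∈ A, min (P {a}) (Q {a}) • Measure.dirac a
  set μ : Measure (E d) := ∑ a ∈ A, (P {a} - Q {a}) • Measure.dirac a with hμ
  set ν : Measure (E d) := ∑ a ∈ A, (Q {a} - P {a}) • Measure.dirac a with hν
  have hPe : P = κ + μ := by
    rw [repr P hP, ← Finset.sum_add_distrib]
    refine Finset.sum_congr rfl fun a _ => ?_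
    rw [← add_smul, min_comm, add_comm]
    congr 1
    rcases le_total (P {a}) (Q {a}) with h | h
    · rw [tsub_eq_zero_of_le h, min_eq_right h, zero_add]
    · rw [min_eq_left h, tsub_add_cancel_of_le h]
  have hQe : Q = κ + ν := by
    rw [repr Q hQ, ← Finset.sum_add_distrib]
    refine Finset.sum_congr rfl fun a _ => ?_
    rw [← add_smul, add_comm]
    congr 1
    rcases le_total (Q {a}) (P {a}) with h | h
    · rw [tsub_eq_zero_of_le h, min_eq_right h, zero_add]
    · rw [min_eq_left h, tsub_add_cancel_of_le h]
  have hκP : κ ≤ P := hPe ▸ Measure.le_add_right le_rfl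
  have hμP : μ ≤ P := hPe ▸ Measure.le_add_left le_rfl
  have hνQ : ν ≤ Q := hQe ▸ Measure.le_add_left le_rfl
  have := isFiniteMeasure_of_le P hκP
  have := isFiniteMeasure_of_le P hμP
  have := isFiniteMeasure_of_le Q hνQ
  have huniv : μ Set.univ = ν Set.univ := by
    have h1 : κ Set.univ + μ Set.univ = κ Set.univ + ν Set.univ := by
      rw [← Measure.add_apply, ← Measure.add_apply, ← hPe, ← hQe, measure_univ, measure_univ]
    exact (ENNReal.add_right_inj (measure_ne_top κ _)).1 h1
  have hμA : ∀ᵐ x ∂μ, x ∈ A := by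
    rw [ae_iff]; exact nonpos_iff_eq_zero.1 ((hμP _).trans_eq hP)
  have hνA : ∀ᵐ x ∂ν, x ∈ A := by
    rw [ae_iff]; exact nonpos_iff_eq_zero.1 ((hνQ _).trans_eq hQ)
  have hbd : ∀ᵐ x ∂μ, ∀ᵐ y ∂ν, ‖x - y‖ₑ ^ p ≤ ∑ a ∈ A, ∑ b ∈ A, ‖a - b‖ₑ ^ p := by
    filter_upwards [hμA] with x hx
    filter_upwards [hνA] with y hy
    exact (Finset.single_le_sum (f := fun b => ‖x - b‖ₑ ^ p) (fun _ _ => zero_le) hy).trans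
      (Finset.single_le_sum (f := fun a => ∑ b ∈ A, ‖a - b‖ₑ ^ p) (fun _ _ => zero_le) hx)
  have hmain := transportCost_add_le (κ := κ) hp huniv hbd
  rw [← hPe, ← hQe] at hmain
  refine hmain.trans_eq ?_
  rw [hμ, Measure.finsetSum_apply]
  simp

end TransportCost

end GroupGoF

/-! ### Convergence in probability of possibly nonmeasurable statistics. -/

namespace GroupGoF

/-- Convergence to zero in `P^n`-probability of `[0, ∞]`-valued statistics. -/
def VanishInProb {d : ℕ} (P : Measure (E d)) (Y : (n : ℕ) → (Fin n → E d) → ℝ≥0∞) : Prop :=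
  ∀ ε : ℝ≥0∞, 0 < ε → Tendsto (fun n => sampleLaw P n {x | ε ≤ Y n x}) atTop (𝓝 0)

instance {d n : ℕ} (P : Measure (E d)) [IsProbabilityMeasure P] :
    IsProbabilityMeasure (sampleLaw P n) := by
  unfold sampleLaw; infer_instance

section VanishInProb

variable {d : ℕ} {P : Measure (E d)} {Y Z W : (n : ℕ) → (Fin n → E d) → ℝ≥0∞}

theorem VanishInProb.mono (hZ : VanishInProb P Z) (h : ∀ᶠ n in atTop, ∀ x, Y n x ≤ Z n x) :
    VanishInProb P Y := fun ε hε =>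
  tendsto_of_tendsto_of_tendsto_of_le_of_le' tendsto_const_nhds (hZ ε hε)
    (Eventually.of_forall fun _ => zero_le)
    (h.mono fun _ hn => measure_mono fun x hx => le_trans hx (hn x))

theorem vanishInProb_zero : VanishInProb P fun _ _ => 0 := fun ε hε => by
  simp [not_le.2 hε]

theorem VanishInProb.add (hY : VanishInProb P Y) (hZ : VanishInProb P Z) :
    VanishInProb P fun n x => Y n x + Z n x := fun ε hε => by
  have hε2 : 0 < ε / 2 := ENNReal.half_pos hε.ne'
  have h := (hY _ hε2).add (hZ _ hε2)
  rw [add_zero] at h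
  refine tendsto_of_tendsto_of_tendsto_of_le_of_le tendsto_const_nhds h (fun _ => zero_le)
    fun n => (measure_mono fun x hx => ?_).trans (measure_union_le _ _)
  by_contra hc
  simp only [Set.mem_union, Set.mem_ofPred_eq, not_or, not_le] at hc hx
  exact (hx.trans_lt (ENNReal.add_lt_add hc.1 hc.2)).ne (ENNReal.add_halves ε).symm

theorem VanishInProb.const_mul (hY : VanishInProb P Y) {C : ℝ≥0∞} (hC : C ≠ ∞) :
    VanishInProb P fun n x => C * Y n x := fun ε hε => by
  refine tendsto_of_tendsto_of_tendsto_of_le_of_le tendsto_const_nhds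
    (hY _ (ENNReal.div_pos hε.ne' hC)) (fun _ => zero_le) fun n => measure_mono fun x hx => ?_
  exact ENNReal.div_le_of_le_mul' hx

theorem VanishInProb.sum {ι : Type*} (s : Finset ι) {Y : ι → (n : ℕ) → (Fin n → E d) → ℝ≥0∞}
    (h : ∀ i ∈ s, VanishInProb P (Y i)) : VanishInProb P fun n x => ∑ i ∈ s, Y i n x := by
  classical
  induction s using Finset.induction_on with
  | empty => simpa using vanishInProb_zero
  | insert a s ha ih =>
    simp only [Finset.sum_insert ha]
    exact (h a (s.mem_insert_self a)).add (ih fun i hi => h i (Finset.mem_insert_of_mem hi))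

/-- The events shrink as `ε` grows. Restricting to `ε ≤ 1` keeps `ε` finite, as Markov's inequality
requires. -/
theorem vanishInProb_of_le_one
    (h : ∀ ε : ℝ≥0∞, 0 < ε → ε ≤ 1 → ∀ η : ℝ≥0∞, 0 < η →
      ∀ᶠ n in atTop, sampleLaw P n {x | ε ≤ Y n x} ≤ η) : VanishInProb P Y := fun ε hε => by
  rw [ENNReal.tendsto_nhds_zero]
  intro η hη
  filter_upwards [h (min ε 1) (lt_min hε one_pos) (min_le_right _ _) η hη] with n hn
  exact (measure_mono fun x (hx : ε ≤ Y n x) => (min_le_left ε 1).trans hx).trans hn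

theorem meas_le_const_mul {n : ℕ} {W : (Fin n → E d) → ℝ≥0∞} (hW : Measurable W) {M : ℝ≥0∞}
    (hM : ∫⁻ x, W x ∂sampleLaw P n ≤ M) {ε t : ℝ≥0∞} (hε : 0 < ε) (hε' : ε ≠ ∞) :
    sampleLaw P n {x | ε ≤ t * W x} ≤ t * M / ε := by
  refine (meas_ge_le_lintegral_div (hW.const_mul t).aemeasurable hε.ne' hε').trans ?_
  rw [lintegral_const_mul _ hW]
  gcongr

theorem exists_pos_forall_mul_lt {C η : ℝ≥0∞} (hC : C ≠ ∞) (hη : 0 < η) :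
    ∃ t : ℝ≥0∞, 0 < t ∧ t < η ∧ C * t < η := by
  have h : Tendsto (fun t : ℝ≥0∞ => C * t) (𝓝[>] 0) (𝓝 0) := by
    have := ENNReal.Tendsto.const_mul (tendsto_id (x := 𝓝 (0 : ℝ≥0∞))) (Or.inr hC)
    simp only [mul_zero] at this
    exact this.mono_left nhdsWithin_le_nhds
  have hlt : ∀ᶠ t : ℝ≥0∞ in 𝓝[>] 0, t < η := nhdsWithin_le_nhds (eventually_lt_nhds hη)
  obtain ⟨t, ht0, ht1, ht2⟩ :=
    ((eventually_mem_nhdsWithin (a := (0 : ℝ≥0∞)) (s := Set.Ioi 0)).and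
      (hlt.and (h.eventually (eventually_lt_nhds hη)))).exists
  exact ⟨t, ht0, ht1, ht2⟩

/-- Approximation up to statistics with arbitrarily small expectations. -/
theorem vanishInProb_of_approx {C : ℝ≥0∞} (hC : C ≠ ∞)
    (h : ∀ δ : ℝ≥0∞, 0 < δ → ∃ W Z : (n : ℕ) → (Fin n → E d) → ℝ≥0∞,
      (∀ n, Measurable (W n)) ∧ (∀ n, ∫⁻ x, W n x ∂sampleLaw P n ≤ δ) ∧ VanishInProb P Z ∧
      ∀ᶠ n in atTop, ∀ x, Y n x ≤ C * (W n x + δ) + Z n x) :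
    VanishInProb P Y := by
  refine vanishInProb_of_le_one fun ε hε hε1 η hη => ?_
  have hεt : ε ≠ ∞ := ne_top_of_le_ne_top ENNReal.one_ne_top hε1
  have hε3 : 0 < ε / 3 := ENNReal.div_pos hε.ne' (by simp)
  have hε3t : ε / 3 ≠ ∞ := by finiteness
  -- One `δ` makes the constant term `C * δ` less than `ε / 3` and the Markov bound for `C * W` at
  -- level `ε / 3` at most `η / 2`.
  obtain ⟨δ, hδ, -, hlt⟩ := exists_pos_forall_mul_lt (C := C + C / (ε / 3)) (η := min (ε / 3) (η / 2))
    (by finiteness) (lt_min hε3 (ENNReal.half_pos hη.ne'))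
  rw [add_mul] at hlt
  have h1 : C * δ < ε / 3 := le_self_add.trans_lt (hlt.trans_le (min_le_left _ _))
  have h2 : C * δ / (ε / 3) ≤ η / 2 := by
    rw [ENNReal.mul_div_right_comm]
    exact le_add_self.trans (hlt.le.trans (min_le_right _ _))
  obtain ⟨W, Z, hW, hWδ, hZ, hle⟩ := h δ hδ
  filter_upwards [hle, (hZ _ hε3).eventually (eventually_lt_nhds (ENNReal.half_pos hη.ne'))]
    with n hn hZn
  calc sampleLaw P n {x | ε ≤ Y n x}
      ≤ sampleLaw P n ({x | ε / 3 ≤ C * W n x} ∪ {x | ε / 3 ≤ Z n x}) := by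
        refine measure_mono fun x hx => ?_
        by_contra hc
        simp only [Set.mem_union, Set.mem_ofPred_eq, not_or, not_le] at hc hx
        have := hx.trans (hn x)
        rw [mul_add] at this
        have h3 := ENNReal.add_lt_add (ENNReal.add_lt_add hc.1 h1) hc.2
        rw [ENNReal.add_thirds] at h3
        exact absurd h3 (not_lt.2 this)
    _ ≤ η / 2 + η / 2 := (measure_union_le _ _).trans
        (add_le_add ((meas_le_const_mul (hW n) (hWδ n) hε3 hε3t).trans h2) hZn.le)
    _ = η := ENNReal.add_halves η

/-- The product of a vanishing statistic and one with bounded expectation vanishes. -/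
theorem VanishInProb.of_mul {D : (n : ℕ) → (Fin n → E d) → ℝ≥0∞} (hD : VanishInProb P D)
    (hW : ∀ n, Measurable (W n)) {M : ℝ≥0∞} (hMt : M ≠ ∞)
    (hM : ∀ n, ∫⁻ x, W n x ∂sampleLaw P n ≤ M) {δ : ℝ≥0∞} (hδ : 0 < δ)
    (h : ∀ n x, D n x < δ → Y n x ≤ D n x * W n x) : VanishInProb P Y := by
  refine vanishInProb_of_le_one fun ε hε hε1 η hη => ?_
  have hεt : ε ≠ ∞ := ne_top_of_le_ne_top ENNReal.one_ne_top hε1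
  -- Where `D < t` the statistic is at most `t * W`, and Markov gives `t * M / ε ≤ η / 2`; `t < δ`
  -- makes the hypothesis `h` available there.
  obtain ⟨t, ht, htlt, hlt⟩ := exists_pos_forall_mul_lt (C := M / ε) (η := min δ (η / 2))
    (by finiteness) (lt_min hδ (ENNReal.half_pos hη.ne'))
  have h2 : t * M / ε ≤ η / 2 := by
    rw [mul_comm t, ENNReal.mul_div_right_comm]
    exact hlt.le.trans (min_le_right _ _)
  filter_upwards [(hD t ht).eventually (eventually_lt_nhds (ENNReal.half_pos hη.ne'))] with n hDn
  calc sampleLaw P n {x | ε ≤ Y n x}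
      ≤ sampleLaw P n ({x | ε ≤ t * W n x} ∪ {x | t ≤ D n x}) := by
        refine measure_mono fun x hx => ?_
        by_contra hc
        simp only [Set.mem_union, Set.mem_ofPred_eq, not_or, not_le] at hc hx
        have h3 := hx.trans (h n x (hc.2.trans (htlt.trans_le (min_le_left _ _))))
        exact absurd (h3.trans (by gcongr; exact hc.2.le)) (not_le.2 hc.1)
    _ ≤ η / 2 + η / 2 := (measure_union_le _ _).trans
        (add_le_add ((meas_le_const_mul (hW n) (hM n) hε hεt).trans h2) hDn.le)
    _ = η := ENNReal.add_halves η

end VanishInProb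

/-! ### Laws of large numbers for empirical measures. -/

section Empirical

variable {d : ℕ} {p : ℝ}

/-- Viewing a sample as a map on a normalized counting measure turns pairing by index into a
coupling. -/
theorem empirical_eq_map {n : ℕ} (z : Fin n → E d) :
    empirical z = ((n : ℝ≥0∞)⁻¹ • Measure.count : Measure (Fin n)).map z := by
  rw [empirical, Measure.map_smul, Measure.count, Measure.sum_fintype,
    Measure.map_finset_sum (measurable_of_finite z).aemeasurable]
  simp [Measure.map_dirac' (measurable_of_finite z)]

theorem lintegral_empirical {n : ℕ} (z : Fin n → E d) {f : E d → ℝ≥0∞} (hf : Measurable f) :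
    ∫⁻ y, f y ∂empirical z = (n : ℝ≥0∞)⁻¹ * ∑ i, f (z i) := by
  rw [empirical, lintegral_smul_measure, lintegral_finsetSum_measure]
  simp [lintegral_dirac' _ hf]

theorem isProbabilityMeasure_empirical {n : ℕ} (hn : n ≠ 0) (z : Fin n → E d) :
    IsProbabilityMeasure (empirical z) :=
  ⟨by simp [empirical, ENNReal.inv_mul_cancel (Nat.cast_ne_zero.2 hn) (ENNReal.natCast_ne_top n)]⟩

theorem transportCost_empirical_le {n : ℕ} (y z : Fin n → E d) :
    transportCost p (empirical y) (empirical z) ≤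
      (n : ℝ≥0∞)⁻¹ * ∑ i, ‖y i - z i‖ₑ ^ p := by
  rw [empirical_eq_map, empirical_eq_map]
  refine (transportCost_map_map_le (measurable_of_finite y) (measurable_of_finite z)).trans_eq ?_
  rw [lintegral_smul_measure, lintegral_count, tsum_fintype, smul_eq_mul]

theorem measurable_average {n : ℕ} {f : E d → ℝ≥0∞} (hf : Measurable f) :
    Measurable (fun x : Fin n → E d => (n : ℝ≥0∞)⁻¹ * ∑ i, f (x i)) := by
  fun_prop

theorem lintegral_average_le (P : Measure (E d)) [IsProbabilityMeasure P] (n : ℕ)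
    {f : E d → ℝ≥0∞} (hf : Measurable f) :
    ∫⁻ x, (n : ℝ≥0∞)⁻¹ * ∑ i, f (x i) ∂sampleLaw P n ≤ ∫⁻ y, f y ∂P := by
  rw [lintegral_const_mul _ (by fun_prop), lintegral_finsetSum _ (by fun_prop)]
  have h : ∀ i : Fin n, ∫⁻ x, f (x i) ∂sampleLaw P n = ∫⁻ y, f y ∂P := fun i =>
    (measurePreserving_eval (fun _ : Fin n => P) i).lintegral_comp hf
  simp only [h, Finset.sum_const, Finset.card_univ, Fintype.card_fin, nsmul_eq_mul, ← mul_assoc]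
  -- `n⁻¹ * n` equals `1` except at `n = 0`, where it is `0`.
  exact mul_le_of_le_one_left zero_le (ENNReal.inv_mul_le_one _)

/-- Weak law of large numbers for the frequency of an event (upper deviations). -/
theorem vanishInProb_frequency_sub (P : Measure (E d)) [IsProbabilityMeasure P] {B : Set (E d)}
    (hB : MeasurableSet B) :
    VanishInProb P fun n x => (n : ℝ≥0∞)⁻¹ * ∑ i, B.indicator 1 (x i) - P B := by
  refine vanishInProb_of_le_one fun ε hε hε1 η hη => ?_
  have hεt : ε ≠ ∞ := ne_top_of_le_ne_top ENNReal.one_ne_top hε1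
  have hr : 0 < ε.toReal := ENNReal.toReal_pos hε.ne' hεt
  set f : E d → ℝ := B.indicator 1 with hf
  have hfm : Measurable f := measurable_one.indicator hB
  have hf01 : ∀ y, f y ∈ Set.Icc (0 : ℝ) 1 := fun y => by
    by_cases hy : y ∈ B <;> simp [hf, hy]
  have hfL : MemLp f 2 P := MemLp.of_bound hfm.aestronglyMeasurable 1
    (ae_of_all _ fun y => by rw [Real.norm_of_nonneg (hf01 y).1]; exact (hf01 y).2)
  have hvar : Var[f; P] ≤ 1 := by
    refine (ProbabilityTheory.variance_le_sq_of_bounded (ae_of_all _ hf01) hfm.aemeasurable).trans ?_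
    norm_num
  -- Chebyshev for a sum of independent indicators, each of variance at most `1`.
  have hbound : ∀ n : ℕ, n ≠ 0 → sampleLaw P n
      {x | ε ≤ (n : ℝ≥0∞)⁻¹ * ∑ i, B.indicator 1 (x i) - P B} ≤
      ENNReal.ofReal (1 / (n * ε.toReal ^ 2)) := by
    intro n hn
    have hn' : (0 : ℝ) < n := by positivity
    set X : (Fin n → E d) → ℝ := ∑ i, fun x => f (x i) with hX
    have hXi : ∀ i : Fin n, MemLp (fun x : Fin n → E d => f (x i)) 2 (sampleLaw P n) := fun i =>
      hfL.comp_measurePreserving (measurePreserving_eval (fun _ : Fin n => P) i)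
    have hXL : MemLp X 2 (sampleLaw P n) := memLp_finsetSum' _ fun i _ => hXi i
    have hXE : (sampleLaw P n)[X] = n * P.real B := by
      simp only [hX, Finset.sum_apply]
      rw [integral_finsetSum _ fun i _ => (hXi i).integrable (by norm_num)]
      have : ∀ i : Fin n, ∫ x, f (x i) ∂sampleLaw P n = P.real B := fun i => by
        rw [← integral_indicator_one hB]
        exact integral_comp_eval (μ := fun _ : Fin n => P) (i := i) hfm.aestronglyMeasurable
      simp [this]
    have hXV : Var[X; sampleLaw P n] ≤ n := by
      have := ProbabilityTheory.variance_sum_pi (μ := fun _ : Fin n => P) (X := fun _ => f)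
        fun _ => hfL
      rw [hX, sampleLaw, this]
      refine (Finset.sum_le_sum fun _ _ => hvar).trans ?_
      simp
    have hc : 0 < n * ε.toReal := by positivity
    refine le_trans (measure_mono fun x hx => ?_)
      ((ProbabilityTheory.meas_ge_le_variance_div_sq hXL hc).trans (ENNReal.ofReal_le_ofReal ?_))
    · have hsum : (n : ℝ≥0∞)⁻¹ * ∑ i, B.indicator 1 (x i) = ENNReal.ofReal (X x / n) := by
        rw [ENNReal.ofReal_div_of_pos hn', ENNReal.ofReal_natCast, ENNReal.div_eq_inv_mul]
        congr 1
        rw [hX, Finset.sum_apply, ENNReal.ofReal_sum_of_nonneg fun i _ => (hf01 (x i)).1]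
        refine Finset.sum_congr rfl fun i _ => ?_
        by_cases hy : x i ∈ B <;> simp [hf, hy]
      rw [Set.mem_ofPred_eq, hsum, ← ofReal_measureReal, ← ENNReal.ofReal_sub _ measureReal_nonneg]
        at hx
      have h1 := (ENNReal.le_ofReal_iff_toReal_le hεt ?_).1 hx
      · rw [Set.mem_ofPred_eq, hXE]
        refine le_trans ?_ (le_abs_self _)
        have := mul_le_mul_of_nonneg_left h1 hn'.le
        rwa [mul_sub, mul_div_cancel₀ _ hn'.ne'] at this
      · by_contra hneg
        rw [ENNReal.ofReal_of_nonpos (not_le.1 hneg).le] at hx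
        exact hε.not_ge hx
    · calc Var[X; sampleLaw P n] / (n * ε.toReal) ^ 2 ≤ n / (n * ε.toReal) ^ 2 := by gcongr
        _ = 1 / (n * ε.toReal ^ 2) := by field_simp
  have hlim : Tendsto (fun n : ℕ => ENNReal.ofReal (1 / (n * ε.toReal ^ 2))) atTop (𝓝 0) := by
    rw [← ENNReal.ofReal_zero]
    refine ENNReal.tendsto_ofReal (tendsto_const_nhds.div_atTop ?_)
    exact tendsto_natCast_atTop_atTop.atTop_mul_const (by positivity)
  filter_upwards [eventually_ne_atTop 0, hlim.eventually (eventually_lt_nhds hη)] with n hn hlt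
  exact (hbound n hn).trans hlt.le

theorem exists_simpleFunc_lintegral_sub_lt (hp : 1 ≤ p) {P : Measure (E d)} {h : E d → E d}
    (hh : Measurable h) (hfin : ∫⁻ x, ‖h x‖ₑ ^ p ∂P < ∞) {δ : ℝ≥0∞} (hδ : 0 < δ) :
    ∃ s : SimpleFunc (E d) (E d), ∫⁻ x, ‖h x - s x‖ₑ ^ p ∂P ≤ δ := by
  have hp0 : 0 < p := by linarith
  have hq0 : ENNReal.ofReal p ≠ 0 := by simpa using hp0
  have hq : (ENNReal.ofReal p).toReal = p := ENNReal.toReal_ofReal hp0.le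
  have hL : MemLp h (ENNReal.ofReal p) P := by
    refine ⟨hh.aestronglyMeasurable, ?_⟩
    rw [eLpNorm_lt_top_iff_lintegral_rpow_enorm_lt_top hq0 ENNReal.ofReal_ne_top, hq]
    exact hfin
  obtain ⟨s, hs, -⟩ := hL.exists_simpleFunc_eLpNorm_sub_lt ENNReal.ofReal_ne_top
    (ε := δ ^ (1 / p)) (by simp [hδ.ne', hp0.le])
  refine ⟨s, ?_⟩
  rw [eLpNorm_eq_lintegral_rpow_enorm_toReal hq0 ENNReal.ofReal_ne_top, hq,
    ENNReal.rpow_lt_rpow_iff (by positivity)] at hs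
  exact hs.le

/-- Both laws live on the finite range of `s`, so the total variation bound reduces the claim to the
frequencies of finitely many fibres. Upper deviations suffice because both masses are `1`. -/
theorem vanishInProb_transportCost_simpleFunc (hp : 0 < p) (P : Measure (E d))
    [IsProbabilityMeasure P] (s : SimpleFunc (E d) (E d)) :
    VanishInProb P fun _ x => transportCost p (empirical fun i => s (x i)) (P.map s) := by
  have : IsProbabilityMeasure (P.map s) :=
    Measure.isProbabilityMeasure_map s.measurable.aemeasurable
  have hC : ∑ a ∈ s.range, ∑ b ∈ s.range, ‖a - b‖ₑ ^ p ≠ ∞ := by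
    refine ENNReal.sum_ne_top.2 fun a _ => ENNReal.sum_ne_top.2 fun b _ => ?_
    finiteness
  refine ((VanishInProb.sum s.range fun a _ => vanishInProb_frequency_sub P
    (s.measurableSet_fiber a)).const_mul hC).mono ?_
  filter_upwards [eventually_ne_atTop 0] with n hn x
  have := isProbabilityMeasure_empirical hn fun i => s (x i)
  have hA : MeasurableSet ((s.range : Set (E d))ᶜ) := s.range.measurableSet.compl
  refine (transportCost_le_sum hp s.range ?_ ?_).trans_eq ?_
  · rw [← lintegral_indicator_one hA,
      lintegral_empirical _ (measurable_one.indicator hA)]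
    simp
  · rw [Measure.map_apply s.measurable hA, SimpleFunc.coe_range]
    convert measure_empty (μ := P)
    ext; simp
  · congr 1
    refine Finset.sum_congr rfl fun a _ => ?_
    rw [Measure.map_apply s.measurable (measurableSet_singleton a),
      ← lintegral_indicator_one (measurableSet_singleton a),
      lintegral_empirical _ (measurable_one.indicator (measurableSet_singleton a))]
    rfl

/-- Convergence of the empirical measure of `h(X_1), …, h(X_n)` in transport cost. -/
theorem vanishInProb_transportCost_empirical (hp : 1 ≤ p) (P : Measure (E d))
    [IsProbabilityMeasure P] {h : E d → E d} (hh : Measurable h)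
    (hfin : ∫⁻ x, ‖h x‖ₑ ^ p ∂P < ∞) :
    VanishInProb P fun _ x => transportCost p (empirical fun i => h (x i)) (P.map h) := by
  set C : ℝ≥0∞ := 2 ^ (p - 1) with hC
  have hCt : C ≠ ∞ := by finiteness
  have hC1 : 1 ≤ C := by
    rw [hC, ← ENNReal.rpow_zero (x := 2)]
    exact ENNReal.rpow_le_rpow_of_exponent_le (by norm_num) (by linarith)
  -- One factor `C` for each of the two triangle inequalities, through the empirical law of `s` and
  -- then through `P.map s`.
  refine vanishInProb_of_approx (C := C * C) (by finiteness) fun δ hδ => ?_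
  obtain ⟨s, hs⟩ := exists_simpleFunc_lintegral_sub_lt hp hh hfin hδ
  have hm : Measurable fun x => ‖h x - s x‖ₑ ^ p := by fun_prop
  refine ⟨fun n x => (n : ℝ≥0∞)⁻¹ * ∑ i, ‖h (x i) - s (x i)‖ₑ ^ p, _,
    fun _ => measurable_average hm, fun n => (lintegral_average_le P n hm).trans hs,
    (vanishInProb_transportCost_simpleFunc (by linarith) P s).const_mul (C := C * C)
      (by finiteness), ?_⟩
  filter_upwards [eventually_ne_atTop 0] with n hn x
  have := isProbabilityMeasure_empirical hn fun i => s (x i)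
  have := isProbabilityMeasure_empirical hn fun i => h (x i)
  have : IsProbabilityMeasure (P.map s) :=
    Measure.isProbabilityMeasure_map s.measurable.aemeasurable
  have h3 : transportCost p (P.map s) (P.map h) ≤ δ := by
    rw [transportCost_comm]
    exact (transportCost_map_map_le hh s.measurable).trans hs
  calc _ ≤ C * (transportCost p (empirical fun i => h (x i)) (empirical fun i => s (x i)) +
        transportCost p (empirical fun i => s (x i)) (P.map h)) :=
        transportCost_triangle hp _ _ _
    _ ≤ C * (C * ((n : ℝ≥0∞)⁻¹ * ∑ i, ‖h (x i) - s (x i)‖ₑ ^ p) +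
        C * (transportCost p (empirical fun i => s (x i)) (P.map s) + δ)) := by
        gcongr
        · exact (transportCost_empirical_le _ _).trans (le_mul_of_one_le_left zero_le hC1)
        · exact (transportCost_triangle hp _ (P.map s) _).trans (by gcongr)
    _ = _ := by ring

end Empirical

end GroupGoF

/-! ### Convergence of the residuals. -/

namespace GroupGoF

section Residuals

variable {d k : ℕ} {p : ℝ} {G : Subgroup (Equiv.Perm (E d))} {Θ : Set (E k)}

theorem lintegral_enorm_rpow_lt_top_of_le (hp : 1 ≤ p) {P : Measure (E d)}
    [IsProbabilityMeasure P] (hP : ∫⁻ x, ‖x‖ₑ ^ p ∂P < ∞) {h : E d → E d} {c : ℝ}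
    (hc : ∀ x, ‖h x‖ ≤ c * (1 + ‖x‖)) : ∫⁻ x, ‖h x‖ₑ ^ p ∂P < ∞ := by
  have hp0 : 0 ≤ p := by linarith
  have hle : ∀ x, ‖h x‖ₑ ^ p ≤
      ENNReal.ofReal c ^ p * (2 ^ (p - 1) * (1 + ‖x‖ₑ ^ p)) := fun x => by
    calc ‖h x‖ₑ ^ p ≤ (ENNReal.ofReal c * (1 + ‖x‖ₑ)) ^ p := by
          refine ENNReal.rpow_le_rpow ?_ hp0
          rw [← ofReal_norm, ← ofReal_norm, ← ENNReal.ofReal_one,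
            ← ENNReal.ofReal_add zero_le_one (norm_nonneg x), ← ENNReal.ofReal_mul' (by positivity)]
          exact ENNReal.ofReal_le_ofReal (hc x)
      _ ≤ _ := by
          rw [ENNReal.mul_rpow_of_nonneg _ _ hp0]
          gcongr
          simpa using ENNReal.rpow_add_le_mul_rpow_add_rpow 1 ‖x‖ₑ hp
  refine (lintegral_mono hle).trans_lt ?_
  rw [lintegral_const_mul _ (by fun_prop), lintegral_const_mul _ (by fun_prop),
    lintegral_add_left measurable_const, lintegral_const, measure_univ]
  finiteness

theorem lintegral_lt_top_of_mem_probP (hp : 0 ≤ p) {P : Measure (E d)} (hP : P ∈ probP d p) :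
    ∫⁻ x, ‖x‖ₑ ^ p ∂P < ∞ := by
  simpa only [ofReal_norm_rpow hp] using hP.2

theorem TendstoInProb.vanishInProb {P : Measure (E d)} {est : (n : ℕ) → (Fin n → E d) → Θ} {θ : Θ}
    (h : TendstoInProb P est θ) (hp : 0 < p) (m : ℝ) :
    VanishInProb P fun n x => ENNReal.ofReal (m * dist (est n x) θ) ^ p := fun ε hε => by
  have hφ : Tendsto (fun t : ℝ => ENNReal.ofReal (m * t) ^ p) (𝓝 0) (𝓝 0) := by
    have : Continuous fun t : ℝ => ENNReal.ofReal (m * t) ^ p :=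
      ENNReal.continuous_rpow_const.comp (ENNReal.continuous_ofReal.comp (by fun_prop))
    simpa [hp] using this.tendsto 0
  obtain ⟨δ, hδ, hlt⟩ := Metric.eventually_nhds_iff.1 (hφ.eventually (eventually_lt_nhds hε))
  refine tendsto_of_tendsto_of_tendsto_of_le_of_le tendsto_const_nhds (h δ hδ)
    (fun _ => zero_le) fun n => measure_mono fun x hx => ?_
  by_contra hc
  rw [Set.mem_ofPred_eq, not_le] at hc
  exact absurd (hlt (y := dist (est n x) θ) (by simpa using hc)) (not_lt.2 hx)

/-- The empirical law of the residuals approaches `(g_θ⁻¹)_# P` when the estimator tends to `θ`. -/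
theorem vanishInProb_transportCost_residuals (hp : 1 ≤ p) (hmeas : ∀ h ∈ G, Measurable h)
    (hbound : ∀ h ∈ G, ∃ c : ℝ, 0 < c ∧ ∀ x, ‖h x‖ ≤ c * (1 + ‖x‖)) (g : Θ ≃ G)
    (hlip : ∀ θ : Θ, ∃ m : ℝ, 0 < m ∧ ∀ᶠ θ' : Θ in 𝓝 θ, ∀ x : E d,
      ‖(g θ' : Equiv.Perm (E d)).symm ((g θ : Equiv.Perm (E d)) x) - x‖
        / (1 + ‖x‖) ≤ m * ‖(θ' : E k) - θ‖)
    {est : (n : ℕ) → (Fin n → E d) → Θ} {P : Measure (E d)} (hP : P ∈ probP d p) {θ : Θ}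
    (hθ : TendstoInProb P est θ) :
    VanishInProb P fun n x => transportCost p (empirical (residuals g est n x))
      (P.map (g θ : Equiv.Perm (E d)).symm) := by
  have hp0 : 0 < p := by linarith
  have : IsProbabilityMeasure P := hP.1
  have hPfin := lintegral_lt_top_of_mem_probP hp0.le hP
  set h : E d → E d := ⇑(g θ : Equiv.Perm (E d)).symm with hh
  have hG : (g θ : Equiv.Perm (E d))⁻¹ ∈ G := G.inv_mem (g θ).2
  have hm : Measurable h := hmeas _ hG
  obtain ⟨c, hc0, hc⟩ := hbound _ hG
  obtain ⟨m, hm0, hev⟩ := hlip θ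
  obtain ⟨δ, hδ, hball⟩ := Metric.eventually_nhds_iff.1 hev
  have hWm : Measurable fun x => (1 + ‖h x‖ₑ) ^ p := by fun_prop
  have hM : ∫⁻ x, (1 + ‖h x‖ₑ) ^ p ∂P < ∞ := by
    refine (lintegral_mono fun x =>
      ENNReal.rpow_add_le_mul_rpow_add_rpow 1 ‖h x‖ₑ hp).trans_lt ?_
    rw [lintegral_const_mul _ (by fun_prop), lintegral_add_left measurable_const, lintegral_const,
      measure_univ]
    have := lintegral_enorm_rpow_lt_top_of_le hp hPfin hc
    finiteness
  have hres : VanishInProb P fun n x => transportCost p (empirical (residuals g est n x))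
      (empirical fun i => h (x i)) := by
    refine (hθ.vanishInProb hp0 m).of_mul (fun n => measurable_average hWm) hM.ne
      (fun n => lintegral_average_le P n hWm) (δ := ENNReal.ofReal (m * δ) ^ p)
      (ENNReal.rpow_pos (by simp [hm0, hδ]) ENNReal.ofReal_ne_top) fun n x hx => ?_
    rw [ENNReal.rpow_lt_rpow_iff hp0, ENNReal.ofReal_lt_ofReal_iff (by positivity)] at hx
    have hb := hball (lt_of_mul_lt_mul_left hx hm0.le)
    refine (transportCost_empirical_le _ _).trans ?_
    rw [mul_left_comm]
    refine mul_le_mul_right ?_ _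
    rw [Finset.mul_sum]
    refine Finset.sum_le_sum fun i _ => ?_
    rw [← ENNReal.mul_rpow_of_nonneg _ _ hp0.le]
    refine ENNReal.rpow_le_rpow ?_ hp0.le
    -- The Lipschitz condition at the point `h (x i)`, which `g θ` sends back to `x i`.
    have hi := hb (h (x i))
    rw [div_le_iff₀ (by positivity), hh, Equiv.apply_symm_apply] at hi
    rw [← ofReal_norm, ← ofReal_norm, ← ENNReal.ofReal_one,
      ← ENNReal.ofReal_add zero_le_one (norm_nonneg _), ← ENNReal.ofReal_mul (by positivity)]
    refine ENNReal.ofReal_le_ofReal ?_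
    rw [Subtype.dist_eq, dist_eq_norm]
    exact hi
  have hemp := vanishInProb_transportCost_empirical hp P hm
    (lintegral_enorm_rpow_lt_top_of_le hp hPfin hc)
  refine ((hres.add hemp).const_mul (C := 2 ^ (p - 1)) (by finiteness)).mono ?_
  filter_upwards [eventually_ne_atTop 0] with n hn x
  have := isProbabilityMeasure_empirical hn (residuals g est n x)
  have := isProbabilityMeasure_empirical hn fun i => h (x i)
  exact transportCost_triangle hp _ _ _

end Residuals

end GroupGoF

/-! ### Null convergence and consistency of the test. -/

theorem mainTheorem4 {d k : ℕ} {p : ℝ} (hp : 1 ≤ p)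
    (Q₀ : Measure (GroupGoF.E d)) (hQ₀ : Q₀ ∈ GroupGoF.probP d p)
    (G : Subgroup (Equiv.Perm (GroupGoF.E d)))
    (hmeas : ∀ h ∈ G, Measurable h)
    (hident : Function.Injective
      (fun h : G => Q₀.map (h : Equiv.Perm (GroupGoF.E d))))
    (hbound : ∀ h ∈ G, ∃ c : ℝ, 0 < c ∧ ∀ x, ‖h x‖ ≤ c * (1 + ‖x‖))
    (Θ : Set (GroupGoF.E k)) (g : Θ ≃ G)
    (hlip : ∀ θ : Θ, ∃ m : ℝ, 0 < m ∧ ∀ᶠ θ' : Θ in 𝓝 θ, ∀ x : GroupGoF.E d,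
      ‖(g θ' : Equiv.Perm (GroupGoF.E d)).symm ((g θ : Equiv.Perm (GroupGoF.E d)) x) - x‖
        / (1 + ‖x‖) ≤ m * ‖(θ' : GroupGoF.E k) - θ‖)
    (est : (n : ℕ) → (Fin n → GroupGoF.E d) → Θ) (hest : ∀ n, Measurable (est n))
    (hequiv : GroupGoF.IsEquivariant Q₀ g est)
    (hcons : GroupGoF.IsWeaklyConsistent Q₀ g est) :
    (∀ θ : Θ, GroupGoF.TendstoInProb (GroupGoF.law Q₀ g θ)
      (GroupGoF.testStat p Q₀ g est) 0) ∧
    (∀ P ∈ GroupGoF.probP d p \ GroupGoF.model Q₀ g,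
      (∃ θ : Θ, GroupGoF.TendstoInProb P est θ) →
      ∀ α ∈ Set.Ioo (0 : ℝ) 1,
        Tendsto
          (fun n => GroupGoF.sampleLaw P n {x | GroupGoF.test p α Q₀ g est n x = 1})
          atTop (𝓝 1)) := by
  have hp0 : 0 < p := by linarith
  have hQprob : IsProbabilityMeasure Q₀ := hQ₀.1
  have hQfin := GroupGoF.lintegral_lt_top_of_mem_probP hp0.le hQ₀
  have hT : ∀ n x, GroupGoF.testStat p Q₀ g est n x =
      (GroupGoF.transportCost p (GroupGoF.empirical (GroupGoF.residuals g est n x)) Q₀).toReal :=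
    fun n x => GroupGoF.wasserstein_rpow hp0 _ _
  have hgm : ∀ θ, Measurable (g θ : Equiv.Perm (GroupGoF.E d)) := fun θ => hmeas _ (g θ).2
  have hgm' : ∀ θ, Measurable (g θ : Equiv.Perm (GroupGoF.E d)).symm := fun θ =>
    hmeas _ (G.inv_mem (g θ).2)
  have hnull : ∀ θ : Θ, GroupGoF.TendstoInProb (GroupGoF.law Q₀ g θ)
      (GroupGoF.testStat p Q₀ g est) 0 := by
    intro θ ε hε
    obtain ⟨c, -, hc⟩ := hbound _ (g θ).2
    have hlaw : GroupGoF.law Q₀ g θ ∈ GroupGoF.probP d p := by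
      refine ⟨Measure.isProbabilityMeasure_map (hgm θ).aemeasurable, ?_⟩
      simp only [GroupGoF.ofReal_norm_rpow hp0.le]
      rw [GroupGoF.law, lintegral_map (by fun_prop) (hgm θ)]
      exact GroupGoF.lintegral_enorm_rpow_lt_top_of_le hp hQfin hc
    have hv := GroupGoF.vanishInProb_transportCost_residuals hp hmeas hbound g hlip hlaw (hcons θ)
    have he : (GroupGoF.law Q₀ g θ).map (g θ : Equiv.Perm (GroupGoF.E d)).symm = Q₀ := by
      rw [GroupGoF.law, Measure.map_map (hgm' θ) (hgm θ), Equiv.symm_comp_self, Measure.map_id]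
    rw [he] at hv
    refine tendsto_of_tendsto_of_tendsto_of_le_of_le tendsto_const_nhds
      (hv _ (ENNReal.ofReal_pos.2 hε)) (fun _ => zero_le) fun n => measure_mono fun x hx => ?_
    rw [Set.mem_ofPred_eq, hT, Real.dist_0_eq_abs, abs_of_nonneg ENNReal.toReal_nonneg] at hx
    exact ENNReal.ofReal_le_of_le_toReal hx
  refine ⟨hnull, ?_⟩
  rintro P ⟨hP, hPM⟩ ⟨θ, hθ⟩ α ⟨hα, -⟩
  have hPprob : IsProbabilityMeasure P := hP.1
  have hQ₀law : GroupGoF.law Q₀ g (g.symm 1) = Q₀ := by simp [GroupGoF.law]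
  set Q := P.map (g θ : Equiv.Perm (GroupGoF.E d)).symm with hQ
  have : IsProbabilityMeasure Q := Measure.isProbabilityMeasure_map (hgm' θ).aemeasurable
  have hw : GroupGoF.transportCost p Q Q₀ ≠ 0 := fun h0 => hPM ⟨θ, by
    rw [GroupGoF.law, ← GroupGoF.eq_of_transportCost_eq_zero hp0 h0, hQ,
      Measure.map_map (hgm θ) (hgm' θ), Equiv.self_comp_symm, Measure.map_id]⟩
  have hv := GroupGoF.vanishInProb_transportCost_residuals hp hmeas hbound g hlip hP hθ
  -- Finiteness guards against `toReal` sending an infinite cost to `0` when the statistic is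
  -- bounded below.
  have hempfin : ∀ {n : ℕ}, n ≠ 0 → ∀ z : Fin n → GroupGoF.E d,
      GroupGoF.transportCost p (GroupGoF.empirical z) Q₀ < ∞ := by
    intro n hn z
    have := GroupGoF.isProbabilityMeasure_empirical hn z
    refine GroupGoF.transportCost_lt_top hp ?_ hQfin
    rw [GroupGoF.lintegral_empirical _ (by fun_prop)]
    have : ∑ i, ‖z i‖ₑ ^ p ≠ ∞ := ENNReal.sum_ne_top.2 fun i _ => by finiteness
    have : (n : ℝ≥0∞) ≠ 0 := by simpa using hn
    finiteness
  -- If the empirical law of the residuals were within cost `a` of both `Q` and `Q₀`, the triangle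
  -- inequality would give `transportCost p Q Q₀ ≤ 2 ^ (p - 1) * 2 * a`, contradicting this choice.
  obtain ⟨a, ha0, -, ha⟩ := GroupGoF.exists_pos_forall_mul_lt
    (C := 2 ^ (p - 1) * 2) (by finiteness) (pos_iff_ne_zero.2 hw)
  have hat : a ≠ ∞ := by
    rintro rfl
    rw [ENNReal.mul_top (by simp)] at ha
    exact not_top_lt ha
  -- With high probability the statistic exceeds `a`, which the null distribution does not.
  have halt : ∀ n ≠ 0, ∀ x : Fin n → GroupGoF.E d,
      GroupGoF.transportCost p (GroupGoF.empirical (GroupGoF.residuals g est n x)) Q < a →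
        a.toReal ≤ GroupGoF.testStat p Q₀ g est n x := by
    intro n hn x hx
    rw [hT]
    refine (ENNReal.toReal_le_toReal hat (hempfin hn _).ne).2 ?_
    by_contra hc
    have := GroupGoF.isProbabilityMeasure_empirical hn (GroupGoF.residuals g est n x)
    have h := GroupGoF.transportCost_triangle hp Q
      (GroupGoF.empirical (GroupGoF.residuals g est n x)) Q₀
    rw [GroupGoF.transportCost_comm Q (GroupGoF.empirical _)] at h
    refine absurd (h.trans ?_) (not_le.2 ha)
    rw [mul_assoc, two_mul]
    gcongr
    exact (not_le.1 hc).le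
  have hnull0 := hnull (g.symm 1) a.toReal (ENNReal.toReal_pos ha0.ne' hat)
  rw [hQ₀law] at hnull0
  -- For `t ≥ a` the null tail beyond `t` is at most that from `a` on. The bound is uniform in `t`,
  -- so the random value of the statistic may be inserted.
  have hcdf : ∀ᶠ n in atTop, ∀ t, a.toReal ≤ t → 1 - GroupGoF.nullCdf p Q₀ g est n t ≤ α := by
    filter_upwards [hnull0.eventually (eventually_lt_nhds (ENNReal.ofReal_pos.2 hα))] with n hn t ht
    have hcov : (1 : ℝ) ≤ (GroupGoF.sampleLaw Q₀ n).real
          {x | a.toReal ≤ dist (GroupGoF.testStat p Q₀ g est n x) 0} +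
        GroupGoF.nullCdf p Q₀ g est n t := by
      rw [← probReal_univ (μ := GroupGoF.sampleLaw Q₀ n)]
      refine (measureReal_mono fun x _ => ?_).trans (measureReal_union_le _ _)
      by_cases hx : a.toReal ≤ GroupGoF.testStat p Q₀ g est n x
      · left
        rw [Set.mem_ofPred_eq, Real.dist_0_eq_abs]
        exact hx.trans (le_abs_self _)
      · exact Or.inr ((not_le.1 hx).le.trans ht)
    have : (GroupGoF.sampleLaw Q₀ n).real
        {x | a.toReal ≤ dist (GroupGoF.testStat p Q₀ g est n x) 0} ≤ α :=
      ENNReal.toReal_le_of_le_ofReal hα.le hn.le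
    linarith
  have hlow : Tendsto (fun n => 1 - GroupGoF.sampleLaw P n {x | a ≤ GroupGoF.transportCost p
      (GroupGoF.empirical (GroupGoF.residuals g est n x)) Q}) atTop (𝓝 1) := by
    have := ENNReal.Tendsto.sub (tendsto_const_nhds (x := (1 : ℝ≥0∞))) (hv a ha0)
      (Or.inl ENNReal.one_ne_top)
    rwa [tsub_zero] at this
  refine tendsto_of_tendsto_of_tendsto_of_le_of_le' hlow tendsto_const_nhds ?_
    (Eventually.of_forall fun n => prob_le_one)
  filter_upwards [hcdf, eventually_ne_atTop 0] with n hn hn0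
  rw [tsub_le_iff_left, ← measure_univ (μ := GroupGoF.sampleLaw P n)]
  refine (measure_mono fun x _ => ?_).trans (measure_union_le _ _)
  by_cases hx : a ≤ GroupGoF.transportCost p
      (GroupGoF.empirical (GroupGoF.residuals g est n x)) Q
  · exact Or.inl hx
  · right
    rw [Set.mem_ofPred_eq, GroupGoF.test, if_pos (hn _ (halt n hn0 x (not_le.1 hx)))]
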